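/- Let $w$ be a Sturmian word over $\{0,1\}$, that is, an infinite word over $\{0,1\}$ that is not ultimately periodic and is balanced (for any two factors $v,v'$ of $w$ of equal length and each letter $x$, the numbers of occurrences of $x$ in $v$ and in $v'$ differ by at most $1$). For finite words of equal length write $v<_{\mathrm{lex}}v'$ if there are a word $\lambda$ and letters $a<b$ such that $\lambda a$ is a prefix of $v$ and $\lambda b$ is a prefix of $v'$. For factors $v<_{\mathrm{lex}}v'$ of $w$ write $v'=\mathrm{succ}_w(v)$ if no factor $f$ of $w$ satisfies $v<_{\mathrm{lex}}f<_{\mathrm{lex}}v'$. A Christoffel factor of $w$ is a factor of $w$ that is unbordered, i.e. whose only borders (words that are both a prefix and a suffix of it) are the empty word and the word itself. Two words are conjugate if they are of the form $\lambda\mu$ and $\mu\lambda$. Then: 1. $w$ has the Nice Factors Ordering property (NFOp): both letters $0$ and $1$ occur in $w$, and for all factors $v,v'$ of $w$ with $v'=\mathrm{succ}_w(v)$ there exist finite (possibly empty) words $\lambda,\mu$ over $\{0,1\}$ such that either $v=\lambda 01\mu$ and $v'=\lambda 10\mu$, or $v=\lambda 0$ and $v'=\lambda 1$. 2. For all factors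 $z,z'$ of $w$ with $z'=\mathrm{succ}_w(z)$ there exist a Christoffel factor $0u1$ of $w$ and a factorization $u=xy$ into (possibly empty) words such that $y01x$ and $y10x$ are conjugates of $0u1$ and factors of $w$, $y10x=\mathrm{succ}_w(y01x)$, $z$ is a prefix of $y01x$, and $z'$ is a prefix of $y10x$. -/

import Mathlib

/-- Infinite words over the alphabet `α`. -/
abbrev InfWord (α : Type*) := ℕ → α

/-- The finite word of length `n` occurring at position `i` in `w`. -/
def InfWord.wordAt {α : Type*} (w : InfWord α) (i n : ℕ) : List α :=
  (List.range n).map fun j => w (i + j)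

/-- `v` is a (finite, possibly empty) factor of `w`. -/
def InfWord.IsFactor {α : Type*} (w : InfWord α) (v : List α) : Prop :=
  ∃ i n : ℕ, v = w.wordAt i n

/-- `w` is ultimately periodic: some tail of `w` is `v v v ⋯` for a nonempty finite word `v`. -/
def InfWord.IsUltimatelyPeriodic {α : Type*} (w : InfWord α) : Prop :=
  ∃ m p : ℕ, 0 < p ∧ Function.Periodic (fun n => w (m + n)) p

/-- Any two factors of `w` of the same length contain each letter equally often, up to an error
of at most one. -/
def InfWord.IsBalanced {α : Type*} [DecidableEq α] (w : InfWord α) : Prop :=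
  ∀ v v' : List α, w.IsFactor v → w.IsFactor v' → v.length = v'.length →
    ∀ x : α, |(v.count x : ℤ) - (v'.count x : ℤ)| ≤ 1

/-- A Sturmian word over the alphabet `{0, 1}` is an aperiodic (that is, not ultimately periodic)
and balanced binary word. -/
def InfWord.IsSturmian (w : InfWord (Fin 2)) : Prop :=
  ¬ w.IsUltimatelyPeriodic ∧ w.IsBalanced

/-- The lexicographic order, which compares finite words of the same length. -/
def LexLT {α : Type*} [LT α] (v v' : List α) : Prop :=
  v.length = v'.length ∧
    ∃ (l : List α) (a b : α), a < b ∧ (l ++ [a]) <+: v ∧ (l ++ [b]) <+: v'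

/-- `v` and `v'` are factors of `w` and `v'` is the lexicographic successor of `v` among the
factors of `w`. -/
def InfWord.IsSucc {α : Type*} [LT α] (w : InfWord α) (v v' : List α) : Prop :=
  w.IsFactor v ∧ w.IsFactor v' ∧ LexLT v v' ∧
    ¬ ∃ f : List α, w.IsFactor f ∧ LexLT v f ∧ LexLT f v'

/-- The only borders (words that are both a prefix and a suffix) of `v` are the empty word
and `v`. -/
def IsUnbordered {α : Type*} (v : List α) : Prop :=
  ∀ b : List α, b <+: v → b <:+ v → b = [] ∨ b = v

/-- A Christoffel word of `w` is an unbordered factor of `w`. -/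
def InfWord.IsChristoffel (w : InfWord (Fin 2)) (v : List (Fin 2)) : Prop :=
  w.IsFactor v ∧ IsUnbordered v

/-- The Nice Factors Ordering property: both letters occur in `w`, and any factor of `w` and its
successor are either `l01m` and `l10m`, or `l0` and `l1`, for some finite words `l`, `m`. -/
def InfWord.NFOp (w : InfWord (Fin 2)) : Prop :=
  (∀ a : Fin 2, w.IsFactor [a]) ∧
    ∀ v v' : List (Fin 2), w.IsSucc v v' →
      (∃ l m : List (Fin 2), v = l ++ [0, 1] ++ m ∧ v' = l ++ [1, 0] ++ m) ∨
      (∃ l : List (Fin 2), v = l ++ [0] ∧ v' = l ++ [1])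

open Filter

/-! ### Comparing words of equal length -/

/-! Balance forbids having both `0p0` and `1p1` as factors (`IsBalanced.not_isFactor`). Hence there
is at most one left special and one right special factor per length, and for `l` left special, `0l`
and `1l` are the least and greatest factors of their length. If `r` is right special and `l` left
special, `r01l` and `r10l` are both factors (`isFactor_append_special`), and nothing lies between
them. Conversely, a factor and its successor have a right special longest common prefix `r`, and
what follows must be `01l` and `10l`, or just `0` and `1` (`special_of_isSucc`). This is the
ordering property.

For the second part, aperiodicity supplies a bispecial `u` at least as long as `z`. By uniqueness
`r` is a suffix of `u`, so `u = xr`, and `l` is a prefix of the left special word `x`. Then `r01x`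
and `r10x` extend `z` and `z'` and are conjugates of `1u0` and `0u1`, which are conjugate to each
other (`isRotated_of_bispecial`). -/

theorem List.exists_divergence {α : Type*} : ∀ {v v' : List α}, v.length = v'.length → v ≠ v' →
    ∃ l c d s t, c ≠ d ∧ v = l ++ c :: s ∧ v' = l ++ d :: t
  | [], [], _, hne => absurd rfl hne
  | a :: v, b :: v', hlen, hne => by
    by_cases hab : a = b
    · subst hab
      obtain ⟨l, c, d, s, t, hcd, rfl, rfl⟩ :=
        List.exists_divergence (v := v) (v' := v') (by simpa using hlen) (by simpa using hne)
      exact ⟨a :: l, c, d, s, t, hcd, rfl, rfl⟩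
    · exact ⟨[], a, b, v, v', hab, rfl, rfl⟩

theorem List.exists_suffix_divergence {α : Type*} {v v' : List α} (hlen : v.length = v'.length)
    (hne : v ≠ v') : ∃ l c d s t, c ≠ d ∧ v = s ++ c :: l ∧ v' = t ++ d :: l := by
  obtain ⟨l, c, d, s, t, hcd, h, h'⟩ :=
    List.exists_divergence (v := v.reverse) (v' := v'.reverse) (by simpa using hlen)
      (by simpa using hne)
  refine ⟨l.reverse, c, d, s.reverse, t.reverse, hcd, ?_, ?_⟩
  · simpa using congrArg List.reverse h
  · simpa using congrArg List.reverse h'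

theorem lexLT_iff {v v' : List (Fin 2)} :
    LexLT v v' ↔ v.length = v'.length ∧ ∃ l s t, v = l ++ 0 :: s ∧ v' = l ++ 1 :: t := by
  constructor
  · rintro ⟨hlen, l, a, b, hab, ⟨s, rfl⟩, ⟨t, rfl⟩⟩
    obtain ⟨rfl, rfl⟩ : a = 0 ∧ b = 1 := by omega
    exact ⟨hlen, l, s, t, by simp, by simp⟩
  · rintro ⟨hlen, l, s, t, rfl, rfl⟩
    exact ⟨hlen, l, 0, 1, by decide, ⟨s, by simp⟩, ⟨t, by simp⟩⟩

theorem lexLT_trichotomy {v v' : List (Fin 2)} (hlen : v.length = v'.length) :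
    v = v' ∨ LexLT v v' ∨ LexLT v' v := by
  by_cases hne : v = v'
  · exact Or.inl hne
  · obtain ⟨l, c, d, s, t, hcd, h, h'⟩ := List.exists_divergence hlen hne
    obtain ⟨rfl, rfl⟩ | ⟨rfl, rfl⟩ : (c = 0 ∧ d = 1) ∨ (c = 1 ∧ d = 0) := by omega
    · exact Or.inr (Or.inl (lexLT_iff.2 ⟨hlen, l, s, t, h, h'⟩))
    · exact Or.inr (Or.inr (lexLT_iff.2 ⟨hlen.symm, l, t, s, h', h⟩))

theorem lexLT_cons {a b : Fin 2} {v v' : List (Fin 2)} :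
    LexLT (a :: v) (b :: v') ↔
      (v.length = v'.length ∧ a = 0 ∧ b = 1) ∨ (a = b ∧ LexLT v v') := by
  constructor
  · intro h
    obtain ⟨hlen, l, s, t, h, h'⟩ := lexLT_iff.1 h
    have hlen' : v.length = v'.length := by simpa using hlen
    cases l with
    | nil =>
      simp only [List.nil_append, List.cons.injEq] at h h'
      exact Or.inl ⟨hlen', h.1, h'.1⟩
    | cons c l =>
      simp only [List.cons_append, List.cons.injEq] at h h'
      exact Or.inr ⟨h.1.trans h'.1.symm, lexLT_iff.2 ⟨hlen', l, s, t, h.2, h'.2⟩⟩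
  · rintro (⟨hlen, rfl, rfl⟩ | ⟨rfl, h⟩)
    · exact lexLT_iff.2 ⟨by simpa using hlen, [], v, v', rfl, rfl⟩
    · obtain ⟨hlen, l, s, t, h, h'⟩ := lexLT_iff.1 h
      exact lexLT_iff.2 ⟨by simpa using hlen, a :: l, s, t, by simp [h], by simp [h']⟩

theorem lexLT_append_left {l v v' : List (Fin 2)} : LexLT (l ++ v) (l ++ v') ↔ LexLT v v' := by
  induction l with
  | nil => rfl
  | cons a l ih =>
    simp only [List.cons_append, lexLT_cons, ih, true_and]
    refine or_iff_right ?_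
    rintro ⟨-, h, h'⟩
    simp [h] at h'

theorem LexLT.lt {v v' : List (Fin 2)} (h : LexLT v v') : v < v' := by
  obtain ⟨-, l, s, t, rfl, rfl⟩ := lexLT_iff.1 h
  exact List.append_left_lt (List.Lex.rel (by decide))

theorem LexLT.exists_append_of_between {f : List (Fin 2)} : ∀ {l v v' : List (Fin 2)},
    LexLT (l ++ v) f → LexLT f (l ++ v') → ∃ g, f = l ++ g := by
  intro l
  induction l generalizing f with
  | nil => intro _ _ _ _; exact ⟨f, rfl⟩
  | cons a l ih =>
    intro v v' h h'
    cases f with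
    | nil => simp [LexLT] at h
    | cons b f =>
      simp only [List.cons_append, lexLT_cons] at h h'
      obtain ⟨rfl, h₁, h₂⟩ : b = a ∧ LexLT (l ++ v) f ∧ LexLT f (l ++ v') := by
        rcases h with ⟨-, h1, h2⟩ | ⟨h1, h2⟩ <;> rcases h' with ⟨-, h3, h4⟩ | ⟨h3, h4⟩
        · simp [h2] at h3
        · simp [← h3, h2] at h1
        · simp [h1, h3] at h4
        · exact ⟨h3, h2, h4⟩
      obtain ⟨g, rfl⟩ := ih h₁ h₂
      exact ⟨g, rfl⟩

namespace InfWord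

/-! ### Factors -/

section Factors

variable {α : Type*} {w : InfWord α}

@[simp] theorem length_wordAt (i n : ℕ) : (w.wordAt i n).length = n := by simp [wordAt]

theorem wordAt_add (i m n : ℕ) : w.wordAt i (m + n) = w.wordAt i m ++ w.wordAt (i + m) n := by
  simp [wordAt, List.range_add, Function.comp_def, add_assoc]

theorem wordAt_one (i : ℕ) : w.wordAt i 1 = [w i] := by simp [wordAt]

theorem wordAt_succ (i n : ℕ) : w.wordAt i (n + 1) = w.wordAt i n ++ [w (i + n)] := by
  rw [wordAt_add, wordAt_one]

theorem wordAt_succ' (i n : ℕ) : w.wordAt i (n + 1) = w i :: w.wordAt (i + 1) n := by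
  rw [add_comm, wordAt_add, wordAt_one]; rfl

theorem isFactor_wordAt (i n : ℕ) : w.IsFactor (w.wordAt i n) := ⟨i, n, rfl⟩

theorem IsFactor.append {s t : List α} (h : w.IsFactor (s ++ t)) :
    w.IsFactor s ∧ w.IsFactor t := by
  obtain ⟨i, n, h⟩ := h
  have hn : n = s.length + t.length := by simpa using (congrArg List.length h).symm
  rw [hn, wordAt_add] at h
  obtain ⟨hs, ht⟩ := List.append_inj h (by simp)
  exact ⟨⟨_, _, hs⟩, ⟨_, _, ht⟩⟩

theorem IsFactor.of_infix {s t : List α} (h : w.IsFactor t) (hs : s <:+: t) : w.IsFactor s := by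
  obtain ⟨a, b, rfl⟩ := hs
  exact h.append.1.append.2

theorem IsFactor.exists_concat {v : List α} (h : w.IsFactor v) : ∃ a, w.IsFactor (v ++ [a]) := by
  obtain ⟨i, n, rfl⟩ := h
  exact ⟨_, wordAt_succ (w := w) i n ▸ isFactor_wordAt i (n + 1)⟩

theorem isUltimatelyPeriodic_of_forall_eq {i j : ℕ} (hij : i < j)
    (h : ∀ t, w (i + t) = w (j + t)) : w.IsUltimatelyPeriodic := by
  refine ⟨i, j - i, Nat.sub_pos_of_lt hij, fun n => ?_⟩
  simp only
  rw [show i + (n + (j - i)) = j + n by omega, h]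

/-- A word all of whose one-letter extensions to the left are factors. -/
def LeftSpecial (w : InfWord α) (v : List α) : Prop := ∀ a, w.IsFactor (a :: v)

/-- A word all of whose one-letter extensions to the right are factors. -/
def RightSpecial (w : InfWord α) (v : List α) : Prop := ∀ a, w.IsFactor (v ++ [a])

theorem LeftSpecial.isFactor {v : List (Fin 2)} {w : InfWord (Fin 2)} (h : w.LeftSpecial v) :
    w.IsFactor v :=
  (h 0).of_infix ⟨[0], [], by simp⟩

theorem LeftSpecial.of_append {s t : List α} (h : w.LeftSpecial (s ++ t)) : w.LeftSpecial s :=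
  fun a => (h a).of_infix ⟨[], t, by simp⟩

theorem RightSpecial.of_append {s t : List α} (h : w.RightSpecial (s ++ t)) : w.RightSpecial t :=
  fun a => (h a).of_infix ⟨s, [], by simp⟩

/-- A word that occurs infinitely often. -/
def Recurs (w : InfWord α) (v : List α) : Prop := ∃ᶠ i in atTop, w.wordAt i v.length = v

theorem Recurs.isFactor {v : List α} (h : w.Recurs v) : w.IsFactor v := by
  obtain ⟨i, hi⟩ := h.exists
  exact ⟨i, _, hi.symm⟩

theorem Recurs.append_left {s t : List α} (h : w.Recurs (s ++ t)) : w.Recurs s := by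
  refine h.mono fun i hi => ?_
  rw [List.length_append, wordAt_add] at hi
  exact (List.append_inj hi (by simp)).1

theorem Recurs.of_cons {a : α} {t : List α} (h : w.Recurs (a :: t)) : w.Recurs t := by
  refine (tendsto_add_atTop_nat 1).frequently (h.mono fun i hi => ?_)
  rw [List.length_cons, wordAt_succ'] at hi
  exact (List.cons.inj hi).2

end Factors

section Binary

variable {w : InfWord (Fin 2)}

theorem Recurs.exists_concat {v : List (Fin 2)} (h : w.Recurs v) : ∃ a, w.Recurs (v ++ [a]) := by
  have key : ∃ᶠ i in atTop, w.wordAt i (v.length + 1) = v ++ [0] ∨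
      w.wordAt i (v.length + 1) = v ++ [1] := by
    refine h.mono fun i hi => ?_
    rw [wordAt_succ, hi]
    generalize w (i + v.length) = a
    fin_cases a <;> simp
  rcases frequently_or_distrib.1 key with h | h
  · exact ⟨0, by simpa [Recurs] using h⟩
  · exact ⟨1, by simpa [Recurs] using h⟩

theorem Recurs.exists_cons {v : List (Fin 2)} (h : w.Recurs v) : ∃ a, w.Recurs (a :: v) := by
  have h' : ∃ᶠ i in atTop, w.wordAt (i + 1) v.length = v := by
    rw [Recurs, frequently_atTop] at h
    rw [frequently_atTop]
    intro N
    obtain ⟨i, hi, hv⟩ := h (N + 1)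
    exact ⟨i - 1, by omega, by rwa [Nat.sub_add_cancel (by omega)]⟩
  have key : ∃ᶠ i in atTop, w.wordAt i (v.length + 1) = 0 :: v ∨
      w.wordAt i (v.length + 1) = 1 :: v := by
    refine h'.mono fun i hi => ?_
    rw [wordAt_succ', hi]
    generalize w i = a
    fin_cases a <;> simp
  rcases frequently_or_distrib.1 key with h | h
  · exact ⟨0, by simpa [Recurs] using h⟩
  · exact ⟨1, by simpa [Recurs] using h⟩

theorem eventually_recurs (w : InfWord (Fin 2)) (n : ℕ) : ∀ᶠ i in atTop, w.Recurs (w.wordAt i n) := by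
  have key : ∀ v ∈ {v : List (Fin 2) | v.length = n},
      ∀ᶠ i in atTop, w.wordAt i n = v → w.Recurs v := by
    rintro v rfl
    by_cases hv : w.Recurs v
    · exact Eventually.of_forall fun _ _ => hv
    · exact (not_frequently.1 hv).mono fun i hi h => absurd h hi
  filter_upwards [(eventually_all_finite (List.finite_length_eq (Fin 2) n)).2 key] with i hi
  exact hi _ (length_wordAt i n) rfl

theorem exists_lt_wordAt_eq (w : InfWord (Fin 2)) (N n : ℕ) :
    ∃ i j, N ≤ i ∧ i < j ∧ w.wordAt i n = w.wordAt j n := by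
  obtain ⟨i, hi, j, hj, hne, h⟩ := (Set.Ici_infinite N).exists_ne_map_eq_of_mapsTo
    (f := fun i => w.wordAt i n) (t := {v : List (Fin 2) | v.length = n}) (fun i _ => by simp)
    (List.finite_length_eq (Fin 2) n)
  rcases hne.lt_or_gt with h' | h'
  · exact ⟨i, j, hi, h', h⟩
  · exact ⟨j, i, hj, h', h.symm⟩

/-- Otherwise, far enough out, each block of length `n` determines the next letter, and a repeated
block forces periodicity. -/
theorem exists_recurs_concat (hw : ¬ w.IsUltimatelyPeriodic) (n : ℕ) :
    ∃ v : List (Fin 2), v.length = n ∧ ∃ a b, a ≠ b ∧ w.Recurs (v ++ [a]) ∧ w.Recurs (v ++ [b]) := by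
  by_contra! hcon
  obtain ⟨N, hN⟩ := eventually_atTop.1 (eventually_recurs w (n + 1))
  have next : ∀ i j, N ≤ i → N ≤ j → w.wordAt i n = w.wordAt j n → w (i + n) = w (j + n) := by
    intro i j hi hj hij
    by_contra hne
    refine hcon (w.wordAt i n) (by simp) _ _ hne ?_ ?_
    · rw [← wordAt_succ]; exact hN i hi
    · rw [hij, ← wordAt_succ]; exact hN j hj
  obtain ⟨i, j, hi, hij, h⟩ := exists_lt_wordAt_eq w N n
  have step : ∀ t, w.wordAt (i + t) n = w.wordAt (j + t) n := by
    intro t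
    induction t with
    | zero => exact h
    | succ t ih =>
      have e : w.wordAt (i + t) (n + 1) = w.wordAt (j + t) (n + 1) := by
        rw [wordAt_succ, wordAt_succ, ih, next _ _ (by omega) (by omega) ih]
      rw [wordAt_succ', wordAt_succ'] at e
      exact (List.cons.inj e).2
  refine hw (isUltimatelyPeriodic_of_forall_eq (i := i + n) (j := j + n) (by omega) fun t => ?_)
  rw [add_right_comm i, add_right_comm j]
  exact next _ _ (by omega) (by omega) (step t)

/-- By counting: there are more recurrent words of length `n + 1` than of length `n`, so deleting
the first letter is not injective on them. -/
theorem exists_recurs_cons (hw : ¬ w.IsUltimatelyPeriodic) (n : ℕ) :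
    ∃ v : List (Fin 2), v.length = n ∧ ∃ a b, a ≠ b ∧ w.Recurs (a :: v) ∧ w.Recurs (b :: v) := by
  let A (m : ℕ) : Set (List (Fin 2)) := {v | v.length = m ∧ w.Recurs v}
  have hfin (m : ℕ) : (A m).Finite := (List.finite_length_eq (Fin 2) m).subset fun v hv => hv.1
  have maps : ∀ v ∈ A (n + 1), v.dropLast ∈ A n := by
    rintro v ⟨hlen, hv⟩
    have hne : v ≠ [] := by rintro rfl; simp at hlen
    rw [← List.dropLast_append_getLast hne] at hv
    exact ⟨by simp [hlen], hv.append_left⟩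
  have hlt : (A n).ncard < (A (n + 1)).ncard := by
    by_contra! hle
    obtain ⟨v, hv, a, b, hab, ha, hb⟩ := exists_recurs_concat hw n
    refine hab ?_
    have := Set.inj_on_of_surj_on_of_ncard_le (s := A (n + 1)) (t := A n)
      (fun v _ => v.dropLast) maps ?_ hle
      (a₁ := v ++ [a]) (a₂ := v ++ [b]) ⟨by simp [hv], ha⟩ ⟨by simp [hv], hb⟩ (by simp) (hfin _)
    · simpa using this
    · rintro u ⟨hu, hr⟩
      obtain ⟨c, hc⟩ := hr.exists_concat
      exact ⟨u ++ [c], ⟨by simp [hu], hc⟩, by simp⟩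
  obtain ⟨u, ⟨hul, hu⟩, v, ⟨hvl, hv⟩, hne, h⟩ :=
    Set.exists_ne_map_eq_of_ncard_lt_of_maps_to (f := List.tail) hlt (by
      rintro (_ | ⟨a, v⟩) ⟨hlen, hv⟩
      · simp at hlen
      · exact ⟨by simpa using hlen, hv.of_cons⟩) (hfin n)
  cases u with
  | nil => simp at hul
  | cons a u =>
    cases v with
    | nil => simp at hvl
    | cons b v =>
      obtain rfl : u = v := h
      exact ⟨u, by simpa using hul, a, b, by simpa using hne, hu, hv⟩

theorem LeftSpecial.of_ne {v : List (Fin 2)} {a b : Fin 2} (hab : a ≠ b) (ha : w.IsFactor (a :: v))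
    (hb : w.IsFactor (b :: v)) : w.LeftSpecial v := by
  intro c
  obtain rfl | rfl : c = a ∨ c = b := by omega
  · exact ha
  · exact hb

theorem RightSpecial.of_ne {v : List (Fin 2)} {a b : Fin 2} (hab : a ≠ b)
    (ha : w.IsFactor (v ++ [a])) (hb : w.IsFactor (v ++ [b])) : w.RightSpecial v := by
  intro c
  obtain rfl | rfl : c = a ∨ c = b := by omega
  · exact ha
  · exact hb

theorem exists_isSucc {z f : List (Fin 2)} (hz : w.IsFactor z) (hf : w.IsFactor f)
    (h : LexLT z f) : ∃ z', w.IsSucc z z' := by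
  let S : Set (List (Fin 2)) := {g | w.IsFactor g ∧ LexLT z g}
  have hS : S.Finite := (List.finite_length_eq (Fin 2) z.length).subset fun g hg => hg.2.1.symm
  obtain ⟨z', ⟨h₁, h₂⟩, hmin⟩ := hS.exists_minimal ⟨f, hf, h⟩
  refine ⟨z', hz, h₁, h₂, ?_⟩
  rintro ⟨g, hg, hzg, hgz⟩
  exact absurd (hmin ⟨hg, hzg⟩ hgz.lt.le) (not_le.2 hgz.lt)

/-! ### Special factors of balanced and Sturmian words -/

theorem IsBalanced.not_isFactor (hw : w.IsBalanced) {a b : Fin 2} (hab : a ≠ b) {p : List (Fin 2)}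
    (ha : w.IsFactor (a :: p ++ [a])) (hb : w.IsFactor (b :: p ++ [b])) : False := by
  have h := hw _ _ ha hb (by simp) a
  have e : (a :: p ++ [a]).count a = p.count a + 2 := by simp
  have e' : (b :: p ++ [b]).count a = p.count a := by simp [hab.symm]
  rw [e, e', abs_le] at h
  push_cast at h
  omega

theorem LeftSpecial.unique (hw : w.IsBalanced) {u v : List (Fin 2)} (hu : w.LeftSpecial u)
    (hv : w.LeftSpecial v) (hlen : u.length = v.length) : u = v := by
  by_contra hne
  obtain ⟨l, c, d, s, t, hcd, rfl, rfl⟩ := List.exists_divergence hlen hne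
  exact hw.not_isFactor hcd (p := l)
    ((hu c).of_infix ⟨[], s, by simp⟩) ((hv d).of_infix ⟨[], t, by simp⟩)

theorem RightSpecial.unique (hw : w.IsBalanced) {u v : List (Fin 2)} (hu : w.RightSpecial u)
    (hv : w.RightSpecial v) (hlen : u.length = v.length) : u = v := by
  by_contra hne
  obtain ⟨l, c, d, s, t, hcd, rfl, rfl⟩ := List.exists_suffix_divergence hlen hne
  exact hw.not_isFactor hcd (p := l)
    ((hu c).of_infix ⟨s, [], by simp⟩) ((hv d).of_infix ⟨t, [], by simp⟩)

theorem LeftSpecial.isPrefix (hw : w.IsBalanced) {u v : List (Fin 2)} (hu : w.LeftSpecial u)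
    (hv : w.LeftSpecial v) (hlen : u.length ≤ v.length) : u <+: v := by
  rw [← List.take_append_drop u.length v] at hv
  rw [hu.unique hw hv.of_append (by simpa using hlen)]
  exact List.take_prefix _ _

theorem RightSpecial.isSuffix (hw : w.IsBalanced) {u v : List (Fin 2)} (hu : w.RightSpecial u)
    (hv : w.RightSpecial v) (hlen : u.length ≤ v.length) : u <:+ v := by
  rw [← List.take_append_drop (v.length - u.length) v] at hv
  rw [hu.unique hw hv.of_append (by simp; omega)]
  exact List.drop_suffix _ _

theorem eq_append_of_bispecial (hw : w.IsBalanced) {u l r : List (Fin 2)}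
    (hl : w.LeftSpecial u) (hr : w.RightSpecial u) (hll : w.LeftSpecial l)
    (hrr : w.RightSpecial r) (hlen : u.length = l.length + r.length) : u = l ++ r := by
  obtain ⟨t, rfl⟩ := hll.isPrefix hw hl (by omega)
  rw [hrr.unique hw hr.of_append (by simpa using hlen.symm)]

namespace IsSturmian

variable (hw : w.IsSturmian)

include hw

/-- Recurrence holds far out and is pulled back one position at a time. It is needed because a
one-sided word does not by itself let factors extend to the left. -/
theorem recurs {v : List (Fin 2)} (hv : w.IsFactor v) : w.Recurs v := by
  obtain ⟨i, n, rfl⟩ := hv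
  cases n with
  | zero => simp [wordAt, Recurs, atTop_neBot]
  | succ n =>
    obtain ⟨N, hN⟩ := eventually_atTop.1 (eventually_recurs w (n + 1))
    by_cases hi : N ≤ i
    · exact hN i hi
    refine Nat.decreasingInduction' (P := fun i => w.Recurs (w.wordAt i (n + 1)))
      (fun j _ _ ih => ?_) (not_le.1 hi).le (hN N le_rfl)
    rw [wordAt_succ] at ih
    have hg := ih.append_left
    have hj : w.IsFactor (w j :: w.wordAt (j + 1) n) := by
      rw [← wordAt_succ']; exact isFactor_wordAt _ _
    rw [wordAt_succ']
    obtain ⟨b, hb⟩ := hg.exists_cons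
    by_cases hbj : w j = b
    · rwa [hbj]
    -- Here the block after `w j` is left special, so it is the unique such word, both of whose left
    -- extensions recur.
    obtain ⟨v, hv, c, d, hcd, hc, hd⟩ := exists_recurs_cons hw.1 n
    rw [(LeftSpecial.of_ne hbj hj hb.isFactor).unique hw.2
      (LeftSpecial.of_ne hcd hc.isFactor hd.isFactor) (by simp [hv])]
    obtain h | h : w j = c ∨ w j = d := by omega
    · rwa [h]
    · rwa [h]

theorem exists_cons {v : List (Fin 2)} (hv : w.IsFactor v) : ∃ a, w.IsFactor (a :: v) :=
  let ⟨a, ha⟩ := (hw.recurs hv).exists_cons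
  ⟨a, ha.isFactor⟩

theorem exists_append {v : List (Fin 2)} (hv : w.IsFactor v) (n : ℕ) :
    ∃ q : List (Fin 2), q.length = n ∧ w.IsFactor (q ++ v) := by
  induction n with
  | zero => exact ⟨[], rfl, hv⟩
  | succ n ih =>
    obtain ⟨q, hq, h⟩ := ih
    obtain ⟨a, ha⟩ := hw.exists_cons h
    exact ⟨a :: q, by simp [hq], ha⟩

theorem exists_leftSpecial (n : ℕ) : ∃ v : List (Fin 2), v.length = n ∧ w.LeftSpecial v := by
  obtain ⟨v, hv, a, b, hab, ha, hb⟩ := exists_recurs_cons hw.1 n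
  exact ⟨v, hv, .of_ne hab ha.isFactor hb.isFactor⟩

/-- Otherwise left special words of length at least `n` extend to the right in only one way, so two
occurrences of one of them begin the same infinite tail. -/
theorem exists_bispecial (n : ℕ) :
    ∃ u : List (Fin 2), n ≤ u.length ∧ w.LeftSpecial u ∧ w.RightSpecial u := by
  by_contra! hcon
  obtain ⟨v, hv, hl⟩ := hw.exists_leftSpecial n
  have hrec := hw.recurs hl.isFactor
  rw [Recurs, frequently_atTop] at hrec
  obtain ⟨i, -, hi⟩ := hrec 0
  obtain ⟨j, hij, hj⟩ := hrec (i + 1)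
  have key : ∀ m, w.wordAt i (n + m) = w.wordAt j (n + m) ∧ w.LeftSpecial (w.wordAt i (n + m)) := by
    intro m
    induction m with
    | zero => rw [add_zero, ← hv, hi, hj]; exact ⟨rfl, hl⟩
    | succ m ih =>
      obtain ⟨u, hu, hul⟩ := hw.exists_leftSpecial (n + m + 1)
      have hnr := hcon (w.wordAt i (n + m)) (by simp) ih.2
      have ext : ∀ k, w.wordAt k (n + m) = w.wordAt i (n + m) → w.wordAt k (n + m + 1) = u := by
        intro k hk
        have hne : u ≠ [] := by rintro rfl; simp at hu
        have hd : u.dropLast ++ [u.getLast hne] = u := List.dropLast_append_getLast hne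
        have hpre : u.dropLast = w.wordAt i (n + m) := by
          refine LeftSpecial.unique hw.2 ?_ ih.2 (by simp [hu])
          rw [← hd] at hul
          exact hul.of_append
        rw [wordAt_succ, hk, ← hd, hpre]
        by_contra hc
        refine hnr (.of_ne (a := w (k + (n + m))) (b := u.getLast hne) (fun h => hc (by rw [h])) ?_ ?_)
        · rw [← hk, ← wordAt_succ]; exact isFactor_wordAt _ _
        · rw [← hpre, hd]; exact hul.isFactor
      rw [← add_assoc, ext i rfl, ext j ih.1.symm]
      exact ⟨rfl, hul⟩
  refine hw.1 (isUltimatelyPeriodic_of_forall_eq (i := i + n) (j := j + n) (by omega) fun t => ?_)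
  have h := (key (t + 1)).1
  rw [← add_assoc, wordAt_succ, wordAt_succ] at h
  have := (List.append_inj h (by simp)).2
  simpa [add_assoc] using this

/-- The word is built letter by letter after `ra`; a wrong continuation would violate balance. -/
theorem isFactor_append_special {r l : List (Fin 2)} (hr : w.RightSpecial r)
    (hl : w.LeftSpecial l) {a b : Fin 2} (hab : a ≠ b) : w.IsFactor (r ++ a :: b :: l) := by
  suffices key : ∀ p t, p ++ t = b :: l → w.IsFactor (r ++ a :: p) from key (b :: l) [] (by simp)
  intro p
  induction p using List.reverseRecOn with
  | nil => intro _ _; exact hr a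
  | append_singleton p c ih =>
    intro t ht
    have hp : w.IsFactor (r ++ a :: p) := ih (c :: t) (by simpa using ht)
    obtain ⟨d, hd⟩ := hp.exists_concat
    by_cases hcd : d = c
    · subst hcd; simpa using hd
    obtain ⟨rfl, rfl⟩ | ⟨rfl, rfl⟩ : (c = b ∧ d = a) ∨ (c = a ∧ d = b) := by omega
    · have hpc : w.IsFactor (p ++ [c]) := by
        have := hl c
        rw [← ht] at this
        exact this.append.1
      -- Some `q` of the length of `ra` precedes `pc`; comparing `q` with `ra` from the right shows
      -- that they agree.
      obtain ⟨q, hq, hqp⟩ := hw.exists_append hpc (r.length + 1)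
      by_cases hqr : q = r ++ [d]
      · subst hqr; simpa using hqp
      exfalso
      obtain ⟨s, x, y, q₁, r₁, hxy, h₁, h₂⟩ :=
        List.exists_suffix_divergence (v := q) (v' := r ++ [d]) (by simpa using hq) hqr
      have hx : w.IsFactor (x :: (s ++ p) ++ [c]) := hqp.of_infix ⟨q₁, [], by simp [h₁]⟩
      have hy : w.IsFactor (y :: (s ++ p) ++ [d]) := by
        refine hd.of_infix ⟨r₁, [], ?_⟩
        rw [show r ++ d :: p = (r ++ [d]) ++ p by simp, h₂]; simp
      obtain ⟨rfl, rfl⟩ | ⟨rfl, rfl⟩ : (x = c ∧ y = d) ∨ (x = d ∧ y = c) := by omega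
      · exact hw.2.not_isFactor hxy hx hy
      · cases s using List.reverseRecOn with
        | nil =>
          have := (List.append_inj' h₂ rfl).2
          simp at this
          exact hxy this
        | append_singleton s e =>
          rw [← List.cons_append, ← List.append_assoc] at h₂
          obtain ⟨h₃, h₄⟩ := List.append_inj' h₂ rfl
          obtain rfl : x = e := by simpa using h₄
          subst h₃
          exact hw.2.not_isFactor hxy (hx.of_infix ⟨[], p ++ [y], by simp⟩) (hr.of_append y)
    · exfalso
      cases p with
      | nil => simp at ht; exact hab ht.1
      | cons e p =>
        simp only [List.cons_append, List.cons.injEq] at ht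
        obtain ⟨rfl, ht⟩ := ht
        refine hw.2.not_isFactor hab (p := p) ?_ (hd.of_infix ⟨r ++ [c], [], by simp⟩)
        have := hl c
        rw [← ht] at this
        exact this.of_infix ⟨[], t, by simp⟩

/-- A larger `s` would contain `1p1` with `p0` a prefix of `l`, while `0l` contains `0p0`. -/
theorem not_one_cons_lexLT {l s : List (Fin 2)} (hl : w.LeftSpecial l) (hs : w.IsFactor s) :
    ¬ LexLT (1 :: l) s := by
  intro h
  obtain ⟨-, p, x, y, h₁, rfl⟩ := lexLT_iff.1 h
  cases p with
  | nil => simp at h₁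
  | cons c p =>
    simp only [List.cons_append, List.cons.injEq] at h₁
    obtain ⟨rfl, rfl⟩ := h₁
    exact hw.2.not_isFactor (a := 0) (b := 1) (by decide) (p := p)
      ((hl 0).of_infix ⟨[], x, by simp⟩) (hs.of_infix ⟨[], y, by simp⟩)

theorem not_lexLT_zero_cons {l s : List (Fin 2)} (hl : w.LeftSpecial l) (hs : w.IsFactor s) :
    ¬ LexLT s (0 :: l) := by
  intro h
  obtain ⟨-, p, x, y, rfl, h₁⟩ := lexLT_iff.1 h
  cases p with
  | nil => simp at h₁
  | cons c p =>
    simp only [List.cons_append, List.cons.injEq] at h₁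
    obtain ⟨rfl, rfl⟩ := h₁
    exact hw.2.not_isFactor (a := 0) (b := 1) (by decide) (p := p)
      (hs.of_infix ⟨[], x, by simp⟩) ((hl 1).of_infix ⟨[], y, by simp⟩)

/-! ### Lexicographic successors -/

theorem isSucc_of_special {r l : List (Fin 2)} (hr : w.RightSpecial r) (hl : w.LeftSpecial l) :
    w.IsSucc (r ++ 0 :: 1 :: l) (r ++ 1 :: 0 :: l) := by
  refine ⟨hw.isFactor_append_special hr hl (by decide), hw.isFactor_append_special hr hl (by decide),
    lexLT_iff.2 ⟨by simp, r, _, _, rfl, rfl⟩, ?_⟩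
  rintro ⟨f, hf, h₁, h₂⟩
  obtain ⟨g, rfl⟩ := LexLT.exists_append_of_between h₁ h₂
  rw [lexLT_append_left] at h₁ h₂
  cases g with
  | nil => simp [LexLT] at h₁
  | cons c g =>
    rw [lexLT_cons] at h₁ h₂
    have hg : w.IsFactor g := hf.of_infix ⟨r ++ [c], [], by simp⟩
    have n₁ := hw.not_one_cons_lexLT hl hg
    have n₂ := hw.not_lexLT_zero_cons hl hg
    rcases h₁ with ⟨-, -, rfl⟩ | ⟨-, h⟩
    · rcases h₂ with ⟨-, h, -⟩ | ⟨-, h⟩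
      · simp at h
      · exact n₂ h
    · exact n₁ h

theorem special_of_isSucc {z z' : List (Fin 2)} (h : w.IsSucc z z') :
    ∃ r, w.RightSpecial r ∧ ((z = r ++ [0] ∧ z' = r ++ [1]) ∨
      ∃ l, w.LeftSpecial l ∧ z = r ++ 0 :: 1 :: l ∧ z' = r ++ 1 :: 0 :: l) := by
  obtain ⟨hz, hz', hlt, hno⟩ := h
  obtain ⟨hlen, r, s, t, rfl, rfl⟩ := lexLT_iff.1 hlt
  have hst : s.length = t.length := by simpa using hlen
  have hr : w.RightSpecial r := .of_ne (a := 0) (b := 1) (by decide)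
    (hz.of_infix ⟨[], s, by simp⟩) (hz'.of_infix ⟨[], t, by simp⟩)
  refine ⟨r, hr, ?_⟩
  rcases Nat.eq_zero_or_pos s.length with h0 | h0
  · obtain rfl := List.length_eq_zero_iff.1 h0
    obtain rfl := List.length_eq_zero_iff.1 (hst.symm.trans h0)
    exact Or.inl ⟨rfl, rfl⟩
  obtain ⟨l, hl, hls⟩ := hw.exists_leftSpecial (s.length - 1)
  have hs : w.IsFactor s := hz.of_infix ⟨r ++ [0], [], by simp⟩
  have ht : w.IsFactor t := hz'.of_infix ⟨r ++ [1], [], by simp⟩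
  -- If `s` were smaller, `r01l` would lie strictly between the two words; it cannot be larger, as
  -- `1l` is maximal.
  obtain rfl : s = 1 :: l := by
    rcases lexLT_trichotomy (v := s) (v' := 1 :: l) (by simp [hl]; omega) with h | h | h
    · exact h
    · refine absurd ⟨_, hw.isFactor_append_special hr hls (by decide : (0 : Fin 2) ≠ 1), ?_, ?_⟩ hno
      · rw [lexLT_append_left, lexLT_cons]; exact Or.inr ⟨rfl, h⟩
      · exact lexLT_iff.2 ⟨by simp [← hst, hl]; omega, r, _, _, rfl, rfl⟩
    · exact absurd h (hw.not_one_cons_lexLT hls hs)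
  obtain rfl : t = 0 :: l := by
    rcases lexLT_trichotomy (v := t) (v' := 0 :: l) (by simp [← hst]) with h | h | h
    · exact h
    · exact absurd h (hw.not_lexLT_zero_cons hls ht)
    · refine absurd ⟨_, hw.isFactor_append_special hr hls (by decide : (1 : Fin 2) ≠ 0), ?_, ?_⟩ hno
      · exact lexLT_iff.2 ⟨by simp, r, _, _, rfl, rfl⟩
      · rw [lexLT_append_left, lexLT_cons]; exact Or.inr ⟨rfl, h⟩
  exact Or.inr ⟨l, hls, rfl, rfl⟩

/-! ### Christoffel words from bispecial factors -/

theorem isFactor_cons_concat {u : List (Fin 2)} (hl : w.LeftSpecial u) (hr : w.RightSpecial u)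
    {a b : Fin 2} (hab : a ≠ b) : w.IsFactor (a :: u ++ [b]) := by
  by_contra h
  obtain ⟨c, hc⟩ := (hl a).exists_concat
  obtain ⟨d, hd⟩ := hw.exists_cons (hr b)
  obtain rfl : c = a := by
    by_contra hca
    obtain rfl : c = b := by omega
    exact h hc
  obtain rfl : d = b := by
    by_contra hdb
    obtain rfl : d = c := by omega
    exact h hd
  exact hw.2.not_isFactor hab hc hd

/-- A proper nonempty border is `0p1` with `p1` a prefix and `0p` a suffix of `u`; bispeciality then
yields both `1p1` and `0p0`. -/
theorem isUnbordered_of_bispecial {u : List (Fin 2)} (hl : w.LeftSpecial u)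
    (hr : w.RightSpecial u) : IsUnbordered ([0] ++ u ++ [1]) := by
  intro b hp hs
  rw [List.prefix_concat_iff] at hp
  rw [List.append_assoc, List.singleton_append, List.suffix_cons_iff] at hs
  rcases hp with hp | hp
  · exact Or.inr hp
  rcases hs with hs | hs
  · exact Or.inr (by simpa using hs)
  rw [List.suffix_concat_iff] at hs
  obtain rfl | ⟨q, rfl, hq⟩ := hs
  · exact Or.inl rfl
  exfalso
  cases q with
  | nil => simp [List.cons_prefix_cons] at hp
  | cons c p =>
    rw [List.singleton_append, List.cons_append, List.cons_prefix_cons] at hp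
    obtain ⟨rfl, s, rfl⟩ := hp
    obtain ⟨t, ht⟩ := hq
    refine hw.2.not_isFactor (a := 0) (b := 1) (by decide) (p := p) ?_
      ((hl 1).of_infix ⟨[], s, by simp⟩)
    have := hr 0
    rw [← ht] at this
    exact this.of_infix ⟨t, [], by simp⟩

/-- Since `1u0` is a larger factor, `0u1` has a successor, so `0u1 = r01l`. Uniqueness gives `u =
lr`, and rotating `r01l` yields `1lr0 = 1u0`. -/
theorem isRotated_of_bispecial {u : List (Fin 2)} (hl : w.LeftSpecial u)
    (hr : w.RightSpecial u) : (0 :: u ++ [1]) ~r (1 :: u ++ [0]) := by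
  obtain ⟨z', hz'⟩ := exists_isSucc (hw.isFactor_cons_concat hl hr (by decide : (0 : Fin 2) ≠ 1))
    (hw.isFactor_cons_concat hl hr (by decide : (1 : Fin 2) ≠ 0))
    (lexLT_iff.2 ⟨by simp, [], _, _, rfl, rfl⟩)
  obtain ⟨r, hrr, ⟨h, -⟩ | ⟨l, hll, h, -⟩⟩ := hw.special_of_isSucc hz'
  · have := (List.append_inj' h rfl).2
    simp at this
  · have hlen : u.length = l.length + r.length := by
      have := congrArg List.length h
      simp at this
      omega
    obtain rfl := eq_append_of_bispecial hw.2 hl hr hll hrr hlen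
    have := List.isRotated_append (l := r ++ [0]) (l' := 1 :: l)
    rw [h]
    simpa using this

end IsSturmian

end Binary

end InfWord

theorem mainTheorem3 (w : InfWord (Fin 2)) (hw : w.IsSturmian) :
    w.NFOp ∧
      ∀ z z' : List (Fin 2), w.IsSucc z z' →
        ∃ u x y : List (Fin 2), u = x ++ y ∧
          w.IsChristoffel ([0] ++ u ++ [1]) ∧
          ([0] ++ u ++ [1]) ~r (y ++ [0, 1] ++ x) ∧
          ([0] ++ u ++ [1]) ~r (y ++ [1, 0] ++ x) ∧
          w.IsSucc (y ++ [0, 1] ++ x) (y ++ [1, 0] ++ x) ∧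
          z <+: (y ++ [0, 1] ++ x) ∧
          z' <+: (y ++ [1, 0] ++ x) := by
  refine ⟨⟨fun a => ?_, fun v v' h => ?_⟩, fun z z' h => ?_⟩
  · obtain ⟨v, hv, hl⟩ := hw.exists_leftSpecial 0
    obtain rfl := List.length_eq_zero_iff.1 hv
    exact hl a
  · obtain ⟨r, -, h | ⟨l, -, rfl, rfl⟩⟩ := hw.special_of_isSucc h
    · exact Or.inr ⟨r, h⟩
    · exact Or.inl ⟨r, l, by simp, by simp⟩
  · obtain ⟨r, hr, hz⟩ := hw.special_of_isSucc h
    obtain ⟨u, hu, hul, hur⟩ := hw.exists_bispecial z.length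
    have hrz : r.length ≤ z.length := by
      rcases hz with ⟨rfl, -⟩ | ⟨l, -, rfl, -⟩ <;> simp
    obtain ⟨x, rfl⟩ := hr.isSuffix hw.2 hur (hrz.trans hu)
    have hx : w.LeftSpecial x := hul.of_append
    have hrot : ([0] ++ (x ++ r) ++ [1]) ~r (r ++ [1, 0] ++ x) := by
      have h : (0 :: x) ++ (r ++ [1]) ~r (r ++ [1]) ++ (0 :: x) := List.isRotated_append
      simpa only [List.append_assoc, List.singleton_append, List.cons_append, List.nil_append] using h
    have hrot' : ([1] ++ (x ++ r) ++ [0]) ~r (r ++ [0, 1] ++ x) := by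
      have h : (1 :: x) ++ (r ++ [0]) ~r (r ++ [0]) ++ (1 :: x) := List.isRotated_append
      simpa only [List.append_assoc, List.singleton_append, List.cons_append, List.nil_append] using h
    refine ⟨x ++ r, x, r, rfl, ⟨?_, hw.isUnbordered_of_bispecial hul hur⟩,
      (hw.isRotated_of_bispecial hul hur).trans hrot', hrot,
      by simpa using hw.isSucc_of_special hr hx, ?_⟩
    · exact hw.isFactor_cons_concat hul hur (by decide)
    · rcases hz with ⟨rfl, rfl⟩ | ⟨l, hl, rfl, rfl⟩
      · exact ⟨⟨1 :: x, by simp⟩, ⟨0 :: x, by simp⟩⟩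
      · obtain ⟨t, rfl⟩ := hl.isPrefix hw.2 hx (by simp at hu; omega)
        exact ⟨⟨t, by simp⟩, ⟨t, by simp⟩⟩
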